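/- Let $G=(\mathcal V,\mathcal E)$ be a simple $D$-regular graph with $N\ge 1$ nodes and $D\ge 1$, let $H_{\mathrm{MC}}=\sum_{(i,j)\in\mathcal E}Z_iZ_j$ be its MaxCut Hamiltonian on $N$ qubits, and let $E_0$ be the minimum eigenvalue of $H_{\mathrm{MC}}$. Fix an orientation $(i,j)$ of every edge. For an even number $p\ge 2$ of rounds, the $p$-round imaginary Hamiltonian variational ansatz ($i$HVA) is $$|\phi(\boldsymbol\theta)\rangle=U^{(p)}_{YZ}U^{(p-1)}_{ZY}\cdots U^{(2)}_{YZ}U^{(1)}_{ZY}\,|+\rangle^{\otimes N},\qquad U^{(l)}_{ZY}=\prod_{(i,j)\in\mathcal E}e^{-i\theta_{l,ij}Z_iY_j/2},\qquad U^{(l)}_{YZ}=\prod_{(i,j)\in\mathcal E}e^{-i\theta_{l,ij}Y_iZ_j/2},$$ where the factors of each product are taken in an arbitrary order, which may differ from round to round, and all $p|\mathcal E|$ angles $\theta_{l,ij}$ are independent and uniform on $[0,2\pi]$. Then the variance of the normalized energy expectation satisfies $$\mathrm{Var}_{\boldsymbol\theta}\Big(\langle\phi(\boldsymbol\theta)|\tfrac{H_{\mathrm{MC}}}{E_0}|\phi(\boldsymbol\theta)\rangle\Big)\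 \ge\ \frac{DN}{E_0^2\,2^{D(p+1)-1}} .$$ Consequently, $i$HVA with a constant number of rounds has no barren plateau on regular graphs of bounded degree: for every $\Delta$ and every even $p\ge2$ there are $c>0$ and $k\in\mathbb N$, depending only on $\Delta$ and $p$, such that this variance is at least $c/N^{k}$ for every $D$-regular graph with $N\ge1$ nodes and $1\le D\le\Delta$ and every arrangement of the gates; and along no sequence of such instances with $N\to\infty$ does the variance vanish exponentially in $N$ (that is, it is not $O(r^{N})$ for any $0<r<1$). -/

import Mathlib

open MeasureTheory ProbabilityTheory Filter
open scoped Matrix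

noncomputable section

namespace IHVA

/-- Operators on `N` qubits, as matrices in the computational basis `{0,1}^N`. -/
abbrev Op (N : ℕ) : Type := Matrix (Fin N → Fin 2) (Fin N → Fin 2) ℂ

/-- The one-qubit operator `A` acting on qubit `i` and the identity on all the other qubits. -/
def onSite {N : ℕ} (i : Fin N) (A : Matrix (Fin 2) (Fin 2) ℂ) : Op N :=
  Matrix.of fun x y => if ∀ k, k ≠ i → x k = y k then A (x i) (y i) else 0

/-- The Pauli operator `Z_i`. -/
def pauliZ {N : ℕ} (i : Fin N) : Op N := onSite i !![1, 0; 0, -1]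

/-- The Pauli operator `Y_i`. -/
def pauliY {N : ℕ} (i : Fin N) : Op N := onSite i !![0, -Complex.I; Complex.I, 0]

theorem pauliZ_eq_diagonal {N : ℕ} (i : Fin N) :
    pauliZ i = Matrix.diagonal
      (fun x : Fin N → Fin 2 => (!![1, 0; 0, -1] : Matrix (Fin 2) (Fin 2) ℂ) (x i) (x i)) := by
  ext x y
  by_cases hxy : x = y
  · subst hxy
    simp [pauliZ, onSite]
  · rw [Matrix.diagonal_apply_ne _ hxy]
    simp only [pauliZ, onSite, Matrix.of_apply]
    split_ifs with h
    · have hi : x i ≠ y i := by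
        intro hi
        apply hxy
        funext k
        by_cases hk : k = i
        · rw [hk, hi]
        · exact h k hk
      revert hi
      generalize x i = a
      generalize y i = b
      intro hi
      fin_cases a <;> fin_cases b <;> simp_all
    · rfl

theorem pauliZ_mul_comm {N : ℕ} (i j : Fin N) :
    (pauliZ i * pauliZ j : Op N) = pauliZ j * pauliZ i := by
  rw [pauliZ_eq_diagonal, pauliZ_eq_diagonal, Matrix.diagonal_mul_diagonal,
    Matrix.diagonal_mul_diagonal]
  congr 1
  funext x
  exact mul_comm _ _

/-- The interaction `Z_i Z_j` of an unordered pair `{i, j}`. -/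
def edgeZZ {N : ℕ} : Sym2 (Fin N) → Op N :=
  Sym2.lift ⟨fun i j => pauliZ i * pauliZ j, pauliZ_mul_comm⟩

/-- The MaxCut Hamiltonian: the sum of `Z_i Z_j` over the edges. -/
def hamiltonian {N : ℕ} (G : SimpleGraph (Fin N)) [DecidableRel G.Adj] : Op N :=
  ∑ e ∈ G.edgeFinset, edgeZZ e

/-- The minimum eigenvalue of the MaxCut Hamiltonian. -/
def groundEnergy {N : ℕ} (G : SimpleGraph (Fin N)) [DecidableRel G.Adj] : ℝ :=
  sInf {E : ℝ | ∃ v : (Fin N → Fin 2) → ℂ, v ≠ 0 ∧ hamiltonian G *ᵥ v = (E : ℂ) • v}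

/-- An arrangement of the gates of the `p`-round ansatz: every edge `e` is written as an ordered
pair `(fst e, snd e)`, and every round carries its own order of the gates, a list in which each
edge occurs exactly once. -/
structure Arrangement {N : ℕ} (G : SimpleGraph (Fin N)) (p : ℕ) where
  fst : G.edgeSet → Fin N
  snd : G.edgeSet → Fin N
  mk_fst_snd : ∀ e, s(fst e, snd e) = (e : Sym2 (Fin N))
  order : Fin p → List G.edgeSet
  nodup_order : ∀ l, (order l).Nodup
  mem_order : ∀ l e, e ∈ order l

/-- One free angle for each round and each edge. -/
abbrev Params {N : ℕ} (G : SimpleGraph (Fin N)) (p : ℕ) : Type := Fin p × G.edgeSet → ℝ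

variable {N : ℕ} {G : SimpleGraph (Fin N)} {p : ℕ}

/-- The gate of the edge `e = (i, j)` in a round: `exp(-i θ Z_i Y_j / 2)` in the first, third, ...
round (index `l = 0, 2, ...`), and `exp(-i θ Y_i Z_j / 2)` in the second, fourth, ... round. -/
def gate (A : Arrangement G p) (θ : Params G p) (l : Fin p) (e : G.edgeSet) : Op N :=
  NormedSpace.exp ((-(Complex.I * (θ (l, e) : ℂ) / 2)) •
    (if Even (l : ℕ) then pauliZ (A.fst e) * pauliY (A.snd e)
      else pauliY (A.fst e) * pauliZ (A.snd e)))

/-- The unitary of one round. -/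
def roundU (A : Arrangement G p) (θ : Params G p) (l : Fin p) : Op N :=
  ((A.order l).map (gate A θ l)).prod

/-- The whole circuit, with the first round rightmost. -/
def circuit (A : Arrangement G p) (θ : Params G p) : Op N :=
  (List.ofFn fun l : Fin p => roundU A θ l).reverse.prod

/-- The product state `|+⟩^{⊗N}`. -/
def plusState (N : ℕ) : (Fin N → Fin 2) → ℂ :=
  fun _ => ∏ _i : Fin N, ((1 / Real.sqrt 2 : ℝ) : ℂ)

/-- The ansatz state. -/
def ansatzState (A : Arrangement G p) (θ : Params G p) : (Fin N → Fin 2) → ℂ :=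
  circuit A θ *ᵥ plusState N

/-- The expectation `⟨ψ|O|ψ⟩` of a Hermitian operator. -/
def expectation (O : Op N) (ψ : (Fin N → Fin 2) → ℂ) : ℝ :=
  (star ψ ⬝ᵥ (O *ᵥ ψ)).re

/-- The uniform probability measure on the torus of all parameters: all angles are independent and
uniform on `[0, 2π]`. -/
def paramMeasure (G : SimpleGraph (Fin N)) [DecidableRel G.Adj] (p : ℕ) : Measure (Params G p) :=
  Measure.pi fun _ => (volume : Measure ℝ)[|Set.Icc 0 (2 * Real.pi)]

/-- The variance, over uniform parameters, of the energy expectation normalized by the ground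
energy. -/
def energyVariance [DecidableRel G.Adj] (A : Arrangement G p) : ℝ :=
  Var[fun θ => expectation (hamiltonian G) (ansatzState A θ) / groundEnergy G; paramMeasure G p]

/-- A barren plateau along a family of instances with `N n` nodes and normalized energy
variance `v n`: the variance vanishes exponentially in the number of nodes. -/
def BarrenPlateau (N : ℕ → ℕ) (v : ℕ → ℝ) : Prop :=
  ∃ r : ℝ, 0 < r ∧ r < 1 ∧ v =O[atTop] fun n => r ^ N n

end IHVA

end

/-! In the Heisenberg picture a gate with Pauli generator `P` and angle `θ` fixes a Pauli operator
`Q` that commutes with `P` and sends an anticommuting one to `cos θ • Q + sin θ • (i P Q)`. The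
energy is therefore a trigonometric polynomial of degree at most one in every angle. Its terms are
indexed by paths `s`, which choose one of `1`, `cos`, `sin` at each gate. These products are
orthogonal, with squared norm `1/2` per nonconstant factor, so the variance is a sum of nonnegative
contributions of paths (`variance_trig_polynomial`), and any family of distinct nonconstant paths
bounds it from below.

For a gate `g` acting by `Z` on `i` and by `Y` on `j`, consider the path that starts from `Z_i Z_j`
and takes the sine branch only at `g`, where it becomes `X_j` up to a phase; `X_j` has expectation
one in the plus state. Along the same path any other edge ends in an operator with an unpaired `Z`,
whose expectation vanishes. So the coefficient of the path in the energy is `-1` (`exists_path`).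

It remains to count nonconstant factors. A gate applied to the state after `g` meets `Z_i Z_j`
nontrivially only if its `Y` sits on `i` or `j`; a gate applied before `g` meets `X_j` only if it
touches `j`. As the roles of `Y` and `Z` alternate, two consecutive rounds put exactly `D` letters
`Y` on each qubit. For `g` in the first two rounds the total is thus less than `D(p+1)`
(`card_mayMeet_lt`), and there are `2|E| = DN` such gates. The polynomial bound then follows from
`E₀² ≤ (DN)²`. -/

namespace IHVA

/-! ### Heisenberg evolution under a gate generated by an involution -/

section Conjugation

variable {R : Type*} [Ring R]

/-- `P` and `Q` commute or anticommute. -/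
def SignComm (P Q : R) : Prop := P * Q = Q * P ∨ P * Q = -(Q * P)

theorem SignComm.symm {P Q : R} (h : SignComm P Q) : SignComm Q P := by
  rcases h with h | h
  · exact Or.inl h.symm
  · exact Or.inr (by rw [h, neg_neg])

theorem SignComm.mul_right {P Q Q' : R} (h : SignComm P Q) (h' : SignComm P Q') :
    SignComm P (Q * Q') := by
  unfold SignComm
  rcases h with h | h <;> rcases h' with h' | h'
  · left; rw [← mul_assoc, h, mul_assoc, h', mul_assoc]
  · right; rw [← mul_assoc, h, mul_assoc, h', mul_neg, mul_assoc]
  · right; rw [← mul_assoc, h, neg_mul, mul_assoc, h', mul_assoc]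
  · left; rw [← mul_assoc, h, neg_mul, mul_assoc, h', mul_neg, neg_neg, mul_assoc]

theorem SignComm.mul_left {P P' Q : R} (h : SignComm P Q) (h' : SignComm P' Q) :
    SignComm (P * P') Q :=
  (h.symm.mul_right h'.symm).symm

variable [Algebra ℂ R]

/-- The trigonometric basis functions `1`, `cos` and `sin`. -/
noncomputable def trig (c : Fin 3) (t : ℝ) : ℝ := ![1, Real.cos t, Real.sin t] c

/-- The coefficients of `1`, `cos t` and `sin t` in the map `O ↦ exp(itP/2) O exp(-itP/2)`,
for an involution `P`. -/
noncomputable def conjTerm (P : R) (c : Fin 3) : Module.End ℂ R :=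
  ![(1 / 2 : ℂ) • (1 + LinearMap.mulLeft ℂ P * LinearMap.mulRight ℂ P),
    (1 / 2 : ℂ) • (1 - LinearMap.mulLeft ℂ P * LinearMap.mulRight ℂ P),
    (Complex.I / 2) • (LinearMap.mulLeft ℂ P - LinearMap.mulRight ℂ P)] c

/-- Only bilinear expansion and the double-angle formulas enter, so `P` may be arbitrary here. -/
theorem conj_eq_sum_conjTerm (P O : R) (t : ℝ) :
    (((Real.cos (t / 2) : ℝ) : ℂ) • (1 : R) + (Complex.I * ((Real.sin (t / 2) : ℝ) : ℂ)) • P) * O *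
      (((Real.cos (t / 2) : ℝ) : ℂ) • (1 : R) - (Complex.I * ((Real.sin (t / 2) : ℝ) : ℂ)) • P) =
    (∑ c, ((trig c t : ℝ) : ℂ) • conjTerm P c) O := by
  have hc : ((Real.cos t : ℝ) : ℂ) =
      ((Real.cos (t / 2) : ℝ) : ℂ) ^ 2 - ((Real.sin (t / 2) : ℝ) : ℂ) ^ 2 := by
    rw [← Complex.ofReal_pow, ← Complex.ofReal_pow, ← Complex.ofReal_sub,
      ← Real.cos_two_mul', mul_div_cancel₀ _ (two_ne_zero)]
  have hs : ((Real.sin t : ℝ) : ℂ) =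
      2 * ((Real.sin (t / 2) : ℝ) : ℂ) * ((Real.cos (t / 2) : ℝ) : ℂ) := by
    have := Real.sin_two_mul (t / 2)
    rw [mul_div_cancel₀ _ (two_ne_zero)] at this
    rw [this]; push_cast; ring
  have h1 : ((Real.cos (t / 2) : ℝ) : ℂ) ^ 2 + ((Real.sin (t / 2) : ℝ) : ℂ) ^ 2 = 1 := by
    exact_mod_cast Real.cos_sq_add_sin_sq (t / 2)
  simp only [Fin.sum_univ_three, trig, conjTerm, Matrix.cons_val_zero, Matrix.cons_val_one,
    Matrix.cons_val, hc, hs, LinearMap.add_apply, LinearMap.smul_apply, LinearMap.sub_apply,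
    Module.End.mul_apply, LinearMap.mulLeft_apply, LinearMap.mulRight_apply, Module.End.one_apply,
    Complex.ofReal_one]
  generalize ((Real.cos (t / 2) : ℝ) : ℂ) = a at *
  generalize ((Real.sin (t / 2) : ℝ) : ℂ) = b at *
  simp only [add_mul, mul_sub, smul_mul_assoc, mul_smul_comm, one_mul, mul_one, smul_smul,
    smul_add, smul_sub, mul_assoc]
  have hI : Complex.I * Complex.I = -1 := Complex.I_mul_I
  match_scalars
  · linear_combination (1 / 2 : ℂ) * h1
  · linear_combination 0 * h1
  · linear_combination 0 * h1
  · linear_combination (-(b ^ 2)) * hI + (1 / 2 : ℂ) * h1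

variable {P Q : R}

/-- For an involution the constant and cosine components are the projections onto the operators that
commute and anticommute with `P`; the sine component is a multiple of the commutator. -/
theorem conjTerm_zero_of_comm (hP : P * P = 1) (h : P * Q = Q * P) : conjTerm P 0 Q = Q := by
  have : P * (Q * P) = Q := by rw [← h, ← mul_assoc, hP, one_mul]
  simp only [conjTerm, Matrix.cons_val_zero, LinearMap.smul_apply, LinearMap.add_apply,
    Module.End.mul_apply, LinearMap.mulLeft_apply, LinearMap.mulRight_apply, Module.End.one_apply,
    this]
  module

theorem conjTerm_one_of_comm (hP : P * P = 1) (h : P * Q = Q * P) : conjTerm P 1 Q = 0 := by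
  have : P * (Q * P) = Q := by rw [← h, ← mul_assoc, hP, one_mul]
  simp only [conjTerm, Matrix.cons_val_one, Matrix.cons_val_zero, LinearMap.smul_apply,
    LinearMap.sub_apply,
    Module.End.mul_apply, LinearMap.mulLeft_apply, LinearMap.mulRight_apply, Module.End.one_apply,
    this]
  module

theorem conjTerm_two_of_comm (h : P * Q = Q * P) : conjTerm P 2 Q = 0 := by
  simp [conjTerm, h]

theorem conjTerm_zero_of_anticomm (hP : P * P = 1) (h : P * Q = -(Q * P)) :
    conjTerm P 0 Q = 0 := by
  have : P * (Q * P) = -Q := by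
    rw [← neg_eq_iff_eq_neg, ← mul_neg, ← h, ← mul_assoc, hP, one_mul]
  simp only [conjTerm, Matrix.cons_val_zero, LinearMap.smul_apply, LinearMap.add_apply,
    Module.End.mul_apply, LinearMap.mulLeft_apply, LinearMap.mulRight_apply, Module.End.one_apply,
    this]
  module

theorem conjTerm_one_of_anticomm (hP : P * P = 1) (h : P * Q = -(Q * P)) :
    conjTerm P 1 Q = Q := by
  have : P * (Q * P) = -Q := by
    rw [← neg_eq_iff_eq_neg, ← mul_neg, ← h, ← mul_assoc, hP, one_mul]
  simp only [conjTerm, Matrix.cons_val_one, Matrix.cons_val_zero, LinearMap.smul_apply,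
    LinearMap.sub_apply,
    Module.End.mul_apply, LinearMap.mulLeft_apply, LinearMap.mulRight_apply, Module.End.one_apply,
    this]
  module

theorem conjTerm_two_of_anticomm (h : P * Q = -(Q * P)) :
    conjTerm P 2 Q = Complex.I • (P * Q) := by
  have h' : Q * P = -(P * Q) := by rw [h, neg_neg]
  simp only [conjTerm, Matrix.cons_val, LinearMap.smul_apply,
    LinearMap.sub_apply, LinearMap.mulLeft_apply, LinearMap.mulRight_apply, h']
  module

theorem conjTerm_apply_eq_smul (hP : P * P = 1) (h : SignComm P Q) {c : Fin 3} (hc : c ≠ 2) :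
    ∃ z : ℂ, conjTerm P c Q = z • Q := by
  have hc' : c = 0 ∨ c = 1 := by fin_cases c <;> simp_all
  rcases hc' with rfl | rfl <;> rcases h with h | h
  · exact ⟨1, by rw [conjTerm_zero_of_comm hP h, one_smul]⟩
  · exact ⟨0, by rw [conjTerm_zero_of_anticomm hP h, zero_smul]⟩
  · exact ⟨0, by rw [conjTerm_one_of_comm hP h, zero_smul]⟩
  · exact ⟨1, by rw [conjTerm_one_of_anticomm hP h, one_smul]⟩

theorem conjTerm_two_apply_eq_smul (h : SignComm P Q) :
    ∃ z : ℂ, conjTerm P 2 Q = z • (P * Q) := by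
  rcases h with h | h
  · exact ⟨0, by rw [conjTerm_two_of_comm h, zero_smul]⟩
  · exact ⟨_, conjTerm_two_of_anticomm h⟩

variable {κ : Type*} {S : κ → R} {s : κ → Fin 3}

/-- Without a sine branch, every factor either keeps `Q` or kills it. -/
theorem prod_conjTerm_apply_eq_smul (hS : ∀ k, S k * S k = 1) (l : List κ)
    (hQ : ∀ k, SignComm (S k) Q) (hs : ∀ k ∈ l, s k ≠ 2) :
    ∃ z : ℂ, (l.map fun k => conjTerm (S k) (s k)).prod Q = z • Q := by
  induction l with
  | nil => exact ⟨1, by simp⟩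
  | cons k l ih =>
    obtain ⟨z, hz⟩ := ih fun k hk => hs k (List.mem_cons_of_mem _ hk)
    obtain ⟨w, hw⟩ := conjTerm_apply_eq_smul (hS k) (hQ k) (hs k List.mem_cons_self)
    refine ⟨z * w, ?_⟩
    rw [List.map_cons, List.prod_cons, Module.End.mul_apply, hz, map_smul, hw, smul_smul]

theorem prod_conjTerm_apply_eq_self (hS : ∀ k, S k * S k = 1) (l : List κ)
    (hs : ∀ k ∈ l, (S k * Q = Q * S k ∧ s k = 0) ∨ (S k * Q = -(Q * S k) ∧ s k = 1)) :
    (l.map fun k => conjTerm (S k) (s k)).prod Q = Q := by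
  induction l with
  | nil => simp
  | cons k l ih =>
    rw [List.map_cons, List.prod_cons, Module.End.mul_apply,
      ih fun k hk => hs k (List.mem_cons_of_mem _ hk)]
    rcases hs k List.mem_cons_self with ⟨h, h0⟩ | ⟨h, h1⟩
    · rw [h0, conjTerm_zero_of_comm (hS k) h]
    · rw [h1, conjTerm_one_of_anticomm (hS k) h]

/-- A path that takes the sine branch exactly at `g` sends a Pauli operator `Q` to a multiple of
`S g * Q`. -/
theorem prod_conjTerm_split_eq_smul (hS : ∀ k, S k * S k = 1) (hSS : ∀ k k', SignComm (S k) (S k'))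
    (l₁ l₂ : List κ) (g : κ) (hQ : ∀ k, SignComm (S k) Q) (hg : s g = 2)
    (h₁ : ∀ k ∈ l₁, s k ≠ 2) (h₂ : ∀ k ∈ l₂, s k ≠ 2) :
    ∃ z : ℂ, ((l₂ ++ g :: l₁).map fun k => conjTerm (S k) (s k)).prod Q = z • (S g * Q) := by
  obtain ⟨z₁, hz₁⟩ := prod_conjTerm_apply_eq_smul hS l₁ hQ h₁
  obtain ⟨z, hz⟩ := conjTerm_two_apply_eq_smul (hQ g)
  obtain ⟨z₂, hz₂⟩ := prod_conjTerm_apply_eq_smul hS l₂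
    (fun k => (hSS k g).mul_right (hQ k)) h₂
  refine ⟨z₁ * z * z₂, ?_⟩
  rw [List.map_append, List.map_cons, List.prod_append, List.prod_cons, Module.End.mul_apply,
    Module.End.mul_apply, hz₁, map_smul, hg, hz, map_smul, map_smul, hz₂, smul_smul, smul_smul]

theorem prod_conjTerm_split_eq (hS : ∀ k, S k * S k = 1) (l₁ l₂ : List κ) (g : κ)
    (hg : s g = 2) (hgQ : S g * Q = -(Q * S g))
    (h₁ : ∀ k ∈ l₁, (S k * Q = Q * S k ∧ s k = 0) ∨ (S k * Q = -(Q * S k) ∧ s k = 1))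
    (h₂ : ∀ k ∈ l₂, (S k * (S g * Q) = S g * Q * S k ∧ s k = 0) ∨
      (S k * (S g * Q) = -(S g * Q * S k) ∧ s k = 1)) :
    ((l₂ ++ g :: l₁).map fun k => conjTerm (S k) (s k)).prod Q = Complex.I • (S g * Q) := by
  rw [List.map_append, List.map_cons, List.prod_append, List.prod_cons, Module.End.mul_apply,
    Module.End.mul_apply, prod_conjTerm_apply_eq_self hS l₁ h₁, hg, conjTerm_two_of_anticomm hgQ,
    map_smul, prod_conjTerm_apply_eq_self hS l₂ h₂]

/-- The product of a list that enumerates a type, as a multilinear map of its factors. -/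
noncomputable def listProdMultilinear {A : Type*} [Ring A] [Algebra ℂ A] [DecidableEq κ] (l : List κ)
    (hl : l.Nodup) (h : ∀ k, k ∈ l) : MultilinearMap ℂ (fun _ : κ => A) A :=
  (MultilinearMap.mkPiAlgebraFin ℂ l.length A).domDomCongr (hl.getEquivOfForallMemList l h)

theorem listProdMultilinear_apply {A : Type*} [Ring A] [Algebra ℂ A] [DecidableEq κ] (l : List κ)
    (hl : l.Nodup) (h : ∀ k, k ∈ l) (m : κ → A) :
    listProdMultilinear l hl h m = (l.map m).prod := by
  rw [listProdMultilinear, MultilinearMap.domDomCongr_apply, MultilinearMap.mkPiAlgebraFin_apply]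
  congr 1
  conv_rhs => rw [← List.ofFn_get l, List.map_ofFn]
  rfl

/-- Noncommutative distributivity: since the list meets each index exactly once, the ordered product
is multilinear in its factors. -/
theorem list_prod_sum_smul {A : Type*} [Ring A] [Algebra ℂ A] [Fintype κ] [DecidableEq κ]
    (l : List κ) (hl : l.Nodup) (h : ∀ k, k ∈ l) (a : κ → Fin 3 → ℂ) (m : κ → Fin 3 → A) :
    (l.map fun k => ∑ c, a k c • m k c).prod =
      ∑ s : κ → Fin 3, (∏ k, a k (s k)) • (l.map fun k => m k (s k)).prod := by
  rw [← listProdMultilinear_apply l hl h, MultilinearMap.map_sum]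
  refine Finset.sum_congr rfl fun s _ => ?_
  rw [MultilinearMap.map_smul_univ, listProdMultilinear_apply]

end Conjugation

/-! ### Algebra of Pauli operators -/

section Sites

variable {N : ℕ}

/-- Row `x` is supported on the columns that agree with `x` off `i`. This reduces identities between
site operators to sums over single qubits. -/
theorem onSite_mulVec (i : Fin N) (A : Matrix (Fin 2) (Fin 2) ℂ) (v : (Fin N → Fin 2) → ℂ)
    (x : Fin N → Fin 2) :
    (onSite i A *ᵥ v) x = ∑ b, A (x i) b * v (Function.update x i b) := by
  rw [Matrix.mulVec, dotProduct]
  symm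
  refine Finset.sum_of_injOn (fun b => Function.update x i b)
    (Function.update_injective x i).injOn (fun _ _ => Finset.mem_coe.2 (Finset.mem_univ _)) ?_ ?_
  · intro y _ hy
    simp only [onSite, Matrix.of_apply]
    rw [if_neg, zero_mul]
    intro h
    refine hy ⟨y i, Finset.mem_coe.2 (Finset.mem_univ _), ?_⟩
    funext k
    by_cases hk : k = i
    · subst hk; simp
    · simp [hk, h k hk]
  · intro b _
    simp only [onSite, Matrix.of_apply]
    rw [if_pos]
    · simp
    · intro k hk; simp [hk]

theorem onSite_mul (i : Fin N) (A B : Matrix (Fin 2) (Fin 2) ℂ) :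
    (onSite i A * onSite i B : Op N) = onSite i (A * B) := by
  refine Matrix.mulVec_injective (funext fun v => funext fun x => ?_)
  rw [← Matrix.mulVec_mulVec, onSite_mulVec, onSite_mulVec]
  simp only [onSite_mulVec, Function.update_self, Function.update_idem, Matrix.mul_apply,
    Finset.mul_sum, Finset.sum_mul]
  rw [Finset.sum_comm]
  simp only [mul_assoc]

theorem onSite_comm {i j : Fin N} (h : i ≠ j) (A B : Matrix (Fin 2) (Fin 2) ℂ) :
    (onSite i A * onSite j B : Op N) = onSite j B * onSite i A := by
  refine Matrix.mulVec_injective (funext fun v => funext fun x => ?_)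
  rw [← Matrix.mulVec_mulVec, ← Matrix.mulVec_mulVec, onSite_mulVec, onSite_mulVec]
  simp only [onSite_mulVec, Finset.mul_sum, Function.update_of_ne h, Function.update_of_ne h.symm]
  rw [Finset.sum_comm]
  simp only [Function.update_comm h, mul_left_comm]

theorem onSite_one (i : Fin N) : (onSite i 1 : Op N) = 1 := by
  refine Matrix.mulVec_injective (funext fun v => funext fun x => ?_)
  rw [onSite_mulVec, Finset.sum_eq_single (x i)]
  · simp
  · intro b _ hb; simp [hb.symm]
  · simp

theorem onSite_smul (i : Fin N) (c : ℂ) (A : Matrix (Fin 2) (Fin 2) ℂ) :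
    (onSite i (c • A) : Op N) = c • onSite i A := by
  ext x y
  simp [onSite]

theorem onSite_neg (i : Fin N) (A : Matrix (Fin 2) (Fin 2) ℂ) :
    (onSite i (-A) : Op N) = -onSite i A := by
  rw [← neg_one_smul ℂ A, onSite_smul, neg_one_smul]

theorem onSite_conjTranspose (i : Fin N) (A : Matrix (Fin 2) (Fin 2) ℂ) :
    (onSite i A : Op N)ᴴ = onSite i Aᴴ := by
  ext x y
  simp only [onSite, Matrix.of_apply, Matrix.conjTranspose_apply, eq_comm (a := x _)]
  split_ifs <;> simp

/-- The Pauli operator `X_i`. -/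
def pauliX (i : Fin N) : Op N := onSite i !![0, 1; 1, 0]

theorem pauliZ_sq (i : Fin N) : (pauliZ i * pauliZ i : Op N) = 1 := by
  rw [pauliZ, onSite_mul, ← onSite_one i]
  congr 1
  ext a b; fin_cases a <;> fin_cases b <;> simp

theorem pauliY_sq (i : Fin N) : (pauliY i * pauliY i : Op N) = 1 := by
  rw [pauliY, onSite_mul, ← onSite_one i]
  congr 1
  ext a b; fin_cases a <;> fin_cases b <;> simp

theorem pauliY_mul_pauliZ (i : Fin N) :
    (pauliY i * pauliZ i : Op N) = Complex.I • pauliX i := by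
  rw [pauliY, pauliZ, onSite_mul, pauliX, ← onSite_smul]
  congr 1
  ext a b; fin_cases a <;> fin_cases b <;> simp

theorem pauliY_mul_pauliZ_anticomm (i : Fin N) :
    (pauliY i * pauliZ i : Op N) = -(pauliZ i * pauliY i) := by
  rw [pauliY, pauliZ, onSite_mul, onSite_mul, ← onSite_neg]
  congr 1
  ext a b; fin_cases a <;> fin_cases b <;> simp

theorem pauliX_mul_pauliZ_anticomm (i : Fin N) :
    (pauliX i * pauliZ i : Op N) = -(pauliZ i * pauliX i) := by
  rw [pauliX, pauliZ, onSite_mul, onSite_mul, ← onSite_neg]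
  congr 1
  ext a b; fin_cases a <;> fin_cases b <;> simp

theorem pauliX_comm_pauliZ {i j : Fin N} (h : i ≠ j) :
    (pauliX i * pauliZ j : Op N) = pauliZ j * pauliX i :=
  onSite_comm h _ _

theorem pauliX_comm_pauliY {i j : Fin N} (h : i ≠ j) :
    (pauliX i * pauliY j : Op N) = pauliY j * pauliX i :=
  onSite_comm h _ _

theorem pauliY_comm_pauliZ {i j : Fin N} (h : i ≠ j) :
    (pauliY i * pauliZ j : Op N) = pauliZ j * pauliY i :=
  onSite_comm h _ _

theorem pauliY_comm_pauliY (i j : Fin N) :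
    (pauliY i * pauliY j : Op N) = pauliY j * pauliY i := by
  by_cases h : i = j
  · rw [h]
  · exact onSite_comm h _ _

theorem signComm_pauliZ_pauliZ (i j : Fin N) : SignComm (pauliZ i : Op N) (pauliZ j) :=
  Or.inl (pauliZ_mul_comm i j)

theorem signComm_pauliY_pauliY (i j : Fin N) : SignComm (pauliY i : Op N) (pauliY j) :=
  Or.inl (pauliY_comm_pauliY i j)

theorem signComm_pauliY_pauliZ (i j : Fin N) : SignComm (pauliY i : Op N) (pauliZ j) := by
  by_cases h : i = j
  · subst h; exact Or.inr (pauliY_mul_pauliZ_anticomm i)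
  · exact Or.inl (pauliY_comm_pauliZ h)

theorem pauliZ_conjTranspose (i : Fin N) : (pauliZ i : Op N)ᴴ = pauliZ i := by
  rw [pauliZ, onSite_conjTranspose]
  congr 1
  ext a b; fin_cases a <;> fin_cases b <;> simp

theorem pauliY_conjTranspose (i : Fin N) : (pauliY i : Op N)ᴴ = pauliY i := by
  rw [pauliY, onSite_conjTranspose]
  congr 1
  ext a b; fin_cases a <;> fin_cases b <;> simp

theorem pauliX_conjTranspose (i : Fin N) : (pauliX i : Op N)ᴴ = pauliX i := by
  rw [pauliX, onSite_conjTranspose]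
  congr 1
  ext a b; fin_cases a <;> fin_cases b <;> simp

/-- The generator `Z_i Y_j` of a two-qubit gate. -/
def pauliZY (i j : Fin N) : Op N := pauliZ i * pauliY j

theorem pauliZY_sq {i j : Fin N} (h : i ≠ j) : pauliZY i j * pauliZY i j = 1 := by
  rw [pauliZY, mul_assoc, ← mul_assoc (pauliY j), pauliY_comm_pauliZ h.symm, mul_assoc, pauliY_sq,
    mul_one, pauliZ_sq]

theorem pauliZY_conjTranspose {i j : Fin N} (h : i ≠ j) : (pauliZY i j)ᴴ = pauliZY i j := by
  rw [pauliZY, Matrix.conjTranspose_mul, pauliZ_conjTranspose, pauliY_conjTranspose,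
    pauliY_comm_pauliZ h.symm]

theorem signComm_pauliZY_pauliZ (i j k : Fin N) : SignComm (pauliZY i j) (pauliZ k) :=
  (signComm_pauliZ_pauliZ i k).mul_left (signComm_pauliY_pauliZ j k)

theorem signComm_pauliZY_pauliY (i j k : Fin N) : SignComm (pauliZY i j) (pauliY k) :=
  (signComm_pauliY_pauliZ k i).symm.mul_left (signComm_pauliY_pauliY j k)

theorem signComm_pauliZY_pauliZY (i j k l : Fin N) : SignComm (pauliZY i j) (pauliZY k l) :=
  (signComm_pauliZY_pauliZ i j k).mul_right (signComm_pauliZY_pauliY i j l)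

theorem commute_mul_right {R : Type*} [Semigroup R] {a b c : R} (h : a * b = b * a)
    (h' : a * c = c * a) : a * (b * c) = b * c * a := by
  rw [← mul_assoc, h, mul_assoc, h', mul_assoc]

theorem pauliZY_comm_pauliZ {i j k : Fin N} (h : j ≠ k) :
    pauliZY i j * pauliZ k = pauliZ k * pauliZY i j :=
  (commute_mul_right (pauliZ_mul_comm k i) (pauliY_comm_pauliZ h).symm).symm

theorem pauliZY_comm_pauliX {i j k : Fin N} (hi : i ≠ k) (hj : j ≠ k) :
    pauliZY i j * pauliX k = pauliX k * pauliZY i j :=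
  (commute_mul_right (pauliX_comm_pauliZ hi.symm) (pauliX_comm_pauliY hj.symm)).symm

/-- `Z_i Y_j` maps `Z_i Z_j` to `X_j`, up to a phase. -/
theorem pauliZY_mul_pauliZ_mul_pauliZ {i j : Fin N} (h : i ≠ j) :
    pauliZY i j * (pauliZ i * pauliZ j) = Complex.I • pauliX j := by
  rw [pauliZY, mul_assoc, ← mul_assoc (pauliY j), pauliY_comm_pauliZ h.symm, mul_assoc,
    ← mul_assoc, pauliZ_sq, one_mul, pauliY_mul_pauliZ]

theorem pauliZY_anticomm {i j : Fin N} (h : i ≠ j) :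
    pauliZY i j * (pauliZ i * pauliZ j) = -(pauliZ i * pauliZ j * pauliZY i j) := by
  have h1 : pauliZY i j * pauliZ j = -(pauliZ j * pauliZY i j) := by
    rw [pauliZY, mul_assoc, pauliY_mul_pauliZ_anticomm, mul_neg, ← mul_assoc, ← mul_assoc,
      pauliZ_mul_comm]
  rw [← mul_assoc, pauliZY_comm_pauliZ h.symm, mul_assoc, h1, mul_neg, mul_assoc]

end Sites

/-! ### Expectations in the plus state -/

section PlusState

variable {N : ℕ}

/-- The expectation in the state `|+⟩^{⊗N}`, as a linear functional. -/
noncomputable def plusFunctional (N : ℕ) : Op N →ₗ[ℂ] ℂ where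
  toFun O := star (plusState N) ⬝ᵥ (O *ᵥ plusState N)
  map_add' := by intro O O'; simp [Matrix.add_mulVec, dotProduct_add]
  map_smul' := by intro c O; simp [Matrix.smul_mulVec, dotProduct_smul]

theorem plusFunctional_apply (O : Op N) :
    plusFunctional N O = star (plusState N) ⬝ᵥ (O *ᵥ plusState N) := rfl

theorem pauliX_mulVec_plusState (i : Fin N) : pauliX i *ᵥ plusState N = plusState N := by
  funext x
  rw [pauliX, onSite_mulVec]
  generalize x i = a
  fin_cases a <;> simp [plusState]

theorem plusFunctional_mul_pauliX (O : Op N) (i : Fin N) :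
    plusFunctional N (O * pauliX i) = plusFunctional N O := by
  rw [plusFunctional_apply, ← Matrix.mulVec_mulVec, pauliX_mulVec_plusState, plusFunctional_apply]

theorem plusFunctional_pauliX_mul (O : Op N) (i : Fin N) :
    plusFunctional N (pauliX i * O) = plusFunctional N O := by
  rw [plusFunctional_apply, ← Matrix.mulVec_mulVec, Matrix.dotProduct_mulVec,
    ← pauliX_conjTranspose, ← Matrix.star_mulVec, pauliX_mulVec_plusState, plusFunctional_apply]

theorem plusFunctional_one : plusFunctional N 1 = 1 := by
  rw [plusFunctional_apply, Matrix.one_mulVec]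
  simp only [dotProduct, plusState, Pi.star_apply, Finset.prod_const, Finset.card_univ,
    Fintype.card_fin, star_pow, Complex.star_def, Complex.conj_ofReal, Finset.sum_const,
    Fintype.card_fun, nsmul_eq_mul, ← mul_pow]
  rw [← Complex.ofReal_mul, div_mul_div_comm, one_mul, Real.mul_self_sqrt zero_le_two]
  push_cast
  rw [← mul_pow]; norm_num

theorem plusFunctional_pauliX (i : Fin N) : plusFunctional N (pauliX i) = 1 := by
  rw [← one_mul (pauliX i), plusFunctional_mul_pauliX, plusFunctional_one]

/-- `X_i` stabilizes the plus state, so it can be absorbed on either side, and the expectation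
equals its own negative. -/
theorem plusFunctional_eq_zero {O : Op N} {i : Fin N}
    (h : pauliX i * O = -(O * pauliX i)) : plusFunctional N O = 0 := by
  have := congrArg (plusFunctional N) h
  rw [map_neg, plusFunctional_mul_pauliX, plusFunctional_pauliX_mul] at this
  exact self_eq_neg.1 this

end PlusState

/-! ### Exponential of an involution -/

section Exponential

variable {R : Type*} [Ring R] [Algebra ℂ R] [TopologicalSpace R] [IsTopologicalRing R]
  [ContinuousSMul ℂ R] [T2Space R]

/-- Even powers of `P` are `1` and odd powers are `P`, so the series splits into those of cosine and
sine. -/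
theorem exp_smul_involution {P : R} (hP : P * P = 1) (t : ℝ) :
    NormedSpace.exp ((-(Complex.I * (t : ℂ) / 2)) • P) =
      ((Real.cos (t / 2) : ℝ) : ℂ) • (1 : R) - (Complex.I * ((Real.sin (t / 2) : ℝ) : ℂ)) • P := by
  rw [NormedSpace.exp_eq_tsum ℂ]
  have hP2 : ∀ n, P ^ (2 * n) = 1 := fun n => by rw [pow_mul, pow_two, hP, one_pow]
  have hc := (Complex.hasSum_cos' (-((t / 2 : ℝ) : ℂ))).smul_const (1 : R)
  have hs := ((Complex.hasSum_sin' (-((t / 2 : ℝ) : ℂ))).mul_left Complex.I).smul_const P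
  have hz : -((t / 2 : ℝ) : ℂ) * Complex.I = -(Complex.I * (t : ℂ) / 2) := by push_cast; ring
  have := HasSum.even_add_odd
    (f := fun n : ℕ => ((n.factorial : ℂ)⁻¹) • ((-(Complex.I * (t : ℂ) / 2)) • P) ^ n)
    (by
      convert hc using 2 with n
      rw [smul_pow, hP2, smul_smul, hz, div_eq_inv_mul _ ((2 * n).factorial : ℂ)])
    (by
      convert hs using 2 with n
      rw [smul_pow, pow_succ P, hP2, one_mul, smul_smul, hz, mul_div_cancel₀ _ Complex.I_ne_zero,
        div_eq_inv_mul _ ((2 * n + 1).factorial : ℂ)])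
  refine this.tsum_eq.trans ?_
  rw [Complex.cos_neg, Complex.sin_neg, Complex.ofReal_cos, Complex.ofReal_sin,
    mul_neg, neg_smul, sub_eq_add_neg]

end Exponential

/-! ### The energy as a trigonometric polynomial -/

section Heisenberg

variable {N p : ℕ} {G : SimpleGraph (Fin N)}

/-- The qubit on which the gate `k` acts by `Z`. -/
def zSite (A : Arrangement G p) (k : Fin p × G.edgeSet) : Fin N :=
  if Even (k.1 : ℕ) then A.fst k.2 else A.snd k.2

/-- The qubit on which the gate `k` acts by `Y`. -/
def ySite (A : Arrangement G p) (k : Fin p × G.edgeSet) : Fin N :=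
  if Even (k.1 : ℕ) then A.snd k.2 else A.fst k.2

/-- The generator of the gate `k`. -/
def generator (A : Arrangement G p) (k : Fin p × G.edgeSet) : Op N :=
  pauliZY (zSite A k) (ySite A k)

theorem Arrangement.fst_ne_snd (A : Arrangement G p) (e : G.edgeSet) : A.fst e ≠ A.snd e := by
  have h : s(A.fst e, A.snd e) ∈ G.edgeSet := by rw [A.mk_fst_snd]; exact e.2
  exact (G.mem_edgeSet.1 h).ne

theorem zSite_ne_ySite (A : Arrangement G p) (k : Fin p × G.edgeSet) : zSite A k ≠ ySite A k := by
  unfold zSite ySite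
  split_ifs
  · exact A.fst_ne_snd _
  · exact (A.fst_ne_snd _).symm

theorem generator_sq (A : Arrangement G p) (k : Fin p × G.edgeSet) :
    generator A k * generator A k = 1 :=
  pauliZY_sq (zSite_ne_ySite A k)

theorem gate_eq (A : Arrangement G p) (θ : Params G p) (l : Fin p) (e : G.edgeSet) :
    gate A θ l e = ((Real.cos (θ (l, e) / 2) : ℝ) : ℂ) • (1 : Op N) -
      (Complex.I * ((Real.sin (θ (l, e) / 2) : ℝ) : ℂ)) • generator A (l, e) := by
  have : (if Even (l : ℕ) then pauliZ (A.fst e) * pauliY (A.snd e)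
      else pauliY (A.fst e) * pauliZ (A.snd e)) = generator A (l, e) := by
    unfold generator zSite ySite pauliZY
    split_ifs
    · rfl
    · exact pauliY_comm_pauliZ (A.fst_ne_snd e)
  rw [gate, this, exp_smul_involution (generator_sq A (l, e))]

theorem gate_conjTranspose (A : Arrangement G p) (θ : Params G p) (l : Fin p) (e : G.edgeSet) :
    (gate A θ l e)ᴴ = ((Real.cos (θ (l, e) / 2) : ℝ) : ℂ) • (1 : Op N) +
      (Complex.I * ((Real.sin (θ (l, e) / 2) : ℝ) : ℂ)) • generator A (l, e) := by
  have h : (generator A (l, e))ᴴ = generator A (l, e) :=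
    pauliZY_conjTranspose (zSite_ne_ySite A _)
  rw [gate_eq, Matrix.conjTranspose_sub, Matrix.conjTranspose_smul, Matrix.conjTranspose_smul, h,
    Matrix.conjTranspose_one, star_mul', Complex.star_def, Complex.conj_ofReal, Complex.conj_I, Complex.conj_ofReal, neg_mul, neg_smul, sub_neg_eq_add]

/-- The leftmost factor is the innermost conjugation, hence the reversal of the list. -/
theorem conjTranspose_list_prod_mul_mul {n κ : Type*} [Fintype n] [DecidableEq n]
    (g : κ → Matrix n n ℂ) (K : κ → Module.End ℂ (Matrix n n ℂ))
    (h : ∀ k O, (g k)ᴴ * O * g k = K k O) (l : List κ) (O : Matrix n n ℂ) :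
    (l.map g).prodᴴ * O * (l.map g).prod = (l.reverse.map K).prod O := by
  induction l generalizing O with
  | nil => simp
  | cons k l ih =>
    rw [List.map_cons, List.prod_cons, List.reverse_cons, List.map_append, List.prod_append,
      Module.End.mul_apply, List.map_singleton, List.prod_singleton, ← h, ← ih,
      Matrix.conjTranspose_mul]
    simp only [mul_assoc]

/-- All the gates, in the order in which they are applied to the state. -/
def gateList (A : Arrangement G p) : List (Fin p × G.edgeSet) :=
  (List.ofFn fun l : Fin p => (A.order l).reverse.map fun e => (l, e)).flatten

theorem mem_gateList (A : Arrangement G p) (k : Fin p × G.edgeSet) : k ∈ gateList A := by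
  simp only [gateList, List.mem_flatten, List.mem_ofFn]
  exact ⟨_, ⟨k.1, rfl⟩, List.mem_map.2 ⟨k.2, List.mem_reverse.2 (A.mem_order _ _), rfl⟩⟩

/-- Used to turn a position before or after a gate in the list into an inequality between rounds. -/
theorem pairwise_gateList (A : Arrangement G p) :
    (gateList A).Pairwise fun k k' => k.1 ≤ k'.1 := by
  rw [gateList, List.pairwise_flatten]
  constructor
  · intro l hl
    obtain ⟨i, rfl⟩ := List.mem_ofFn.1 hl
    rw [List.pairwise_map]
    exact List.pairwise_of_forall fun _ _ => le_rfl
  · rw [List.pairwise_ofFn]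
    intro i j hij x hx y hy
    obtain ⟨_, _, rfl⟩ := List.mem_map.1 hx
    obtain ⟨_, _, rfl⟩ := List.mem_map.1 hy
    exact hij.le

theorem nodup_gateList (A : Arrangement G p) : (gateList A).Nodup := by
  rw [gateList, List.nodup_flatten]
  constructor
  · intro l hl
    obtain ⟨i, rfl⟩ := List.mem_ofFn.1 hl
    exact (List.nodup_reverse.2 (A.nodup_order i)).map fun _ _ h => (Prod.mk.inj h).2
  · rw [List.pairwise_ofFn]
    intro i j hij
    rw [List.disjoint_left]
    intro x hx hy
    obtain ⟨_, _, rfl⟩ := List.mem_map.1 hx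
    obtain ⟨_, _, h⟩ := List.mem_map.1 hy
    exact hij.ne (Prod.mk.inj h).1.symm

theorem circuit_eq_prod (A : Arrangement G p) (θ : Params G p) :
    circuit A θ = ((gateList A).reverse.map fun k => gate A θ k.1 k.2).prod := by
  rw [gateList, List.reverse_flatten, List.map_flatten, List.prod_flatten, circuit]
  simp only [List.map_reverse, List.map_ofFn]
  congr 3
  funext l
  simp [roundU, Function.comp_def]

/-- The Fourier coefficients of the expectation of `O` in the ansatz state. -/
noncomputable def coeff (A : Arrangement G p) (O : Op N) (s : Fin p × G.edgeSet → Fin 3) : ℂ :=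
  plusFunctional N (((gateList A).map fun k => conjTerm (generator A k) (s k)).prod O)

theorem expectation_ansatzState [Fintype G.edgeSet] [DecidableEq G.edgeSet] (A : Arrangement G p)
    (O : Op N) (θ : Params G p) :
    expectation O (ansatzState A θ) =
      ∑ s : Fin p × G.edgeSet → Fin 3, (∏ k, trig (s k) (θ k)) * (coeff A O s).re := by
  have h : star (ansatzState A θ) ⬝ᵥ (O *ᵥ ansatzState A θ) =
      ∑ s : Fin p × G.edgeSet → Fin 3, ((∏ k, trig (s k) (θ k) : ℝ) : ℂ) * coeff A O s := by
    rw [ansatzState, Matrix.star_mulVec, ← Matrix.dotProduct_mulVec, Matrix.mulVec_mulVec,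
      Matrix.mulVec_mulVec, ← plusFunctional_apply, circuit_eq_prod,
      conjTranspose_list_prod_mul_mul _
        (fun k => ∑ c, ((trig c (θ k) : ℝ) : ℂ) • conjTerm (generator A k) c),
      List.reverse_reverse, list_prod_sum_smul _ (nodup_gateList A) (mem_gateList A)
        (fun k c => ((trig c (θ k) : ℝ) : ℂ)) (fun k c => conjTerm (generator A k) c),
      LinearMap.sum_apply, map_sum]
    · simp only [LinearMap.smul_apply, map_smul, smul_eq_mul, coeff, Complex.ofReal_prod]
    · intro k O
      rw [← conj_eq_sum_conjTerm, gate_conjTranspose, gate_eq]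
  rw [expectation, h, Complex.re_sum]
  simp only [Complex.re_ofReal_mul]

end Heisenberg

/-! ### Orthogonality and Parseval -/

section Variance

/-- The uniform probability measure on `[0, 2π]`. -/
noncomputable abbrev uniformAngle : Measure ℝ := (volume : Measure ℝ)[|Set.Icc 0 (2 * Real.pi)]

instance : IsProbabilityMeasure uniformAngle :=
  cond_isProbabilityMeasure_of_finite
    (by rw [Real.volume_Icc]; simp [Real.pi_pos]) (by rw [Real.volume_Icc]; exact ENNReal.ofReal_ne_top)

theorem integral_uniformAngle (f : ℝ → ℝ) :
    ∫ t, f t ∂uniformAngle = (2 * Real.pi)⁻¹ * ∫ t in (0 : ℝ)..(2 * Real.pi), f t := by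
  rw [uniformAngle, ProbabilityTheory.cond, integral_smul_measure,
    intervalIntegral.integral_of_le Real.two_pi_pos.le, integral_Icc_eq_integral_Ioc,
    Real.volume_Icc, sub_zero, ENNReal.toReal_inv, ENNReal.toReal_ofReal Real.two_pi_pos.le,
    smul_eq_mul]

theorem integral_trig_mul_trig (c d : Fin 3) :
    ∫ t, trig c t * trig d t ∂uniformAngle =
      if c = d then (if c = 0 then 1 else 1 / 2) else 0 := by
  rw [integral_uniformAngle]
  have := Real.pi_pos.ne'
  have hsc := integral_sin_mul_cos₁ (a := 0) (b := 2 * Real.pi)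
  have hcs : ∫ x in (0 : ℝ)..(2 * Real.pi), Real.cos x * Real.sin x = 0 := by
    simp only [mul_comm (Real.cos _), hsc]; simp
  have hss := integral_sin_sq (a := 0) (b := 2 * Real.pi)
  have hcc := integral_cos_sq (a := 0) (b := 2 * Real.pi)
  fin_cases c <;> fin_cases d <;> simp [trig, ← pow_two, hsc, hcs, hss, hcc] <;> field_simp

variable {κ : Type*} [Fintype κ]

/-- By independence the integral factors over the angles: one mismatch gives a factor zero, and
otherwise each sine or cosine contributes `1/2`. -/
theorem integral_prod_trig_mul_prod_trig (s s' : κ → Fin 3) :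
    ∫ θ : κ → ℝ, (∏ k, trig (s k) (θ k)) * (∏ k, trig (s' k) (θ k))
        ∂(Measure.pi fun _ => uniformAngle) =
      if s = s' then (1 / 2 : ℝ) ^ (Finset.univ.filter fun k => s k ≠ 0).card else 0 := by
  simp only [← Finset.prod_mul_distrib]
  rw [integral_fintype_prod_eq_prod (f := fun k t => trig (s k) t * trig (s' k) t)]
  simp only [integral_trig_mul_trig]
  split_ifs with h
  · subst h
    simp only [if_true, ← ite_not (s _ = 0), Finset.prod_ite, Finset.prod_const, one_pow, mul_one]
  · obtain ⟨k, hk⟩ := Function.ne_iff.1 h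
    exact Finset.prod_eq_zero (Finset.mem_univ k) (if_neg hk)

theorem abs_trig_le_one (c : Fin 3) (t : ℝ) : |trig c t| ≤ 1 := by
  fin_cases c
  · simp [trig]
  · exact Real.abs_cos_le_one t
  · exact Real.abs_sin_le_one t

theorem continuous_trig (c : Fin 3) : Continuous (trig c) := by
  fin_cases c
  · exact continuous_const
  · exact Real.continuous_cos
  · exact Real.continuous_sin

theorem memLp_prod_trig (s : κ → Fin 3) (q : ENNReal) :
    MemLp (fun θ : κ → ℝ => ∏ k, trig (s k) (θ k)) q (Measure.pi fun _ => uniformAngle) := by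
  refine MemLp.of_bound (C := 1) ?_ (ae_of_all _ fun θ => ?_)
  · exact (continuous_finsetProd _ fun k _ =>
      (continuous_trig (s k)).comp (continuous_apply k)).aestronglyMeasurable
  · rw [Real.norm_eq_abs, Finset.abs_prod]
    exact Finset.prod_le_one (fun _ _ => abs_nonneg _) fun _ _ => abs_trig_le_one _ _

/-- **Parseval's identity** for the variance of a trigonometric polynomial that is of degree at
most one in every angle. -/
theorem variance_trig_polynomial [DecidableEq κ] (a : (κ → Fin 3) → ℝ) :
    Var[fun θ : κ → ℝ => ∑ s : κ → Fin 3, (∏ k, trig (s k) (θ k)) * a s;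
        Measure.pi fun _ => uniformAngle] =
      ∑ s ∈ Finset.univ.erase 0,
        a s ^ 2 * (1 / 2 : ℝ) ^ (Finset.univ.filter fun k => s k ≠ 0).card := by
  have hint : ∀ s : κ → Fin 3, Integrable (fun θ : κ → ℝ => (∏ k, trig (s k) (θ k)) * a s)
      (Measure.pi fun _ => uniformAngle) := fun s =>
    ((memLp_prod_trig s 1).integrable le_rfl).mul_const _
  have hint2 : ∀ s s' : κ → Fin 3, Integrable (fun θ : κ → ℝ =>
      (∏ k, trig (s k) (θ k)) * a s * ((∏ k, trig (s' k) (θ k)) * a s'))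
      (Measure.pi fun _ => uniformAngle) := fun s s' =>
    ((memLp_prod_trig s 2).mul_const (a s)).integrable_mul ((memLp_prod_trig s' 2).mul_const (a s'))
  -- The mean comes from the constant path alone, which is why the variance omits exactly `s = 0`.
  have hmean : ∫ θ : κ → ℝ, ∑ s : κ → Fin 3, (∏ k, trig (s k) (θ k)) * a s
      ∂(Measure.pi fun _ => uniformAngle) = a 0 := by
    rw [integral_finsetSum _ fun s _ => hint s, Finset.sum_eq_single 0]
    · rw [integral_mul_const]
      simp [trig]
    · intro s _ hs
      have := integral_prod_trig_mul_prod_trig s 0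
      rw [if_neg hs] at this
      rw [integral_mul_const]
      simp only [Pi.zero_apply, trig, Matrix.cons_val_zero, Finset.prod_const_one, mul_one] at this
      simp only [trig, this, zero_mul]
    · simp
  have hsq : ∫ θ : κ → ℝ, (∑ s : κ → Fin 3, (∏ k, trig (s k) (θ k)) * a s) ^ 2
      ∂(Measure.pi fun _ => uniformAngle) = ∑ s : κ → Fin 3,
        a s ^ 2 * (1 / 2 : ℝ) ^ (Finset.univ.filter fun k => s k ≠ 0).card := by
    simp only [pow_two (∑ s : κ → Fin 3, _), Finset.sum_mul_sum]
    rw [integral_finsetSum _ fun s _ => integrable_finsetSum _ fun s' _ => hint2 s s']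
    refine Finset.sum_congr rfl fun s _ => ?_
    rw [integral_finsetSum _ fun s' _ => hint2 s s']
    simp only [mul_mul_mul_comm _ (a s), integral_mul_const, integral_prod_trig_mul_prod_trig]
    simp only [ite_mul, zero_mul, Finset.sum_ite_eq, Finset.mem_univ, if_true]
    ring
  rw [variance_eq_sub (memLp_finsetSum _ fun s _ => (memLp_prod_trig s 2).mul_const (a s))]
  simp only [Pi.pow_apply]
  rw [hmean, hsq, ← Finset.add_sum_erase _ _ (Finset.mem_univ (0 : κ → Fin 3))]
  simp

end Variance

/-! ### Paths with a single sine branch -/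

section Paths

variable {N p : ℕ} {G : SimpleGraph (Fin N)}

theorem edgeZZ_eq (A : Arrangement G p) (k : Fin p × G.edgeSet) :
    edgeZZ (k.2 : Sym2 (Fin N)) = pauliZ (zSite A k) * pauliZ (ySite A k) := by
  rw [← A.mk_fst_snd k.2]
  unfold zSite ySite
  split_ifs
  · rfl
  · exact pauliZ_mul_comm _ _

theorem sym2_sites (A : Arrangement G p) (k : Fin p × G.edgeSet) :
    s(zSite A k, ySite A k) = (k.2 : Sym2 (Fin N)) := by
  rw [← A.mk_fst_snd k.2]
  unfold zSite ySite
  split_ifs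
  · rfl
  · exact Sym2.eq_swap

/-- Only one factor `Z_a` occurs, so the product anticommutes with `X_a`. -/
theorem plusFunctional_pauliZ_mul_eq_zero {i j a b : Fin N} (hi : a ≠ i) (hj : a ≠ j)
    (hb : a ≠ b) :
    plusFunctional N (pauliZ i * pauliZ j * (pauliZ a * pauliZ b)) = 0 := by
  refine plusFunctional_eq_zero (i := a) ?_
  have h1 : (pauliX a * (pauliZ i * pauliZ j) : Op N) = pauliZ i * pauliZ j * pauliX a :=
    commute_mul_right (pauliX_comm_pauliZ hi) (pauliX_comm_pauliZ hj)
  have h2 : (pauliX a * (pauliZ a * pauliZ b) : Op N) = -(pauliZ a * pauliZ b * pauliX a) := by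
    rw [← mul_assoc, pauliX_mul_pauliZ_anticomm, neg_mul, mul_assoc, pauliX_comm_pauliZ hb,
      mul_assoc]
  rw [← mul_assoc, h1, mul_assoc, h2, mul_neg, ← mul_assoc]

/-- Two distinct edges share at most one vertex, so some endpoint of `e` avoids both `i` and `j`. -/
theorem plusFunctional_edgeZZ_mul_eq_zero {i j : Fin N} {e : Sym2 (Fin N)} (he : ¬ e.IsDiag)
    (hne : e ≠ s(i, j)) : plusFunctional N (pauliZ i * pauliZ j * edgeZZ e) = 0 := by
  induction e using Sym2.ind with
  | _ a b =>
    have hab : a ≠ b := by simpa using he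
    change plusFunctional N (pauliZ i * pauliZ j * (pauliZ a * pauliZ b)) = 0
    by_cases ha : a ≠ i ∧ a ≠ j
    · exact plusFunctional_pauliZ_mul_eq_zero ha.1 ha.2 hab
    · rw [pauliZ_mul_comm a b]
      refine plusFunctional_pauliZ_mul_eq_zero ?_ ?_ hab.symm
      · rintro rfl
        refine hne ?_
        by_cases h : a = j
        · rw [h, Sym2.eq_swap]
        · exact absurd ⟨hab, h⟩ ha
      · rintro rfl
        refine hne ?_
        by_cases h : a = i
        · rw [h]
        · exact absurd ⟨h, hab⟩ ha

theorem signComm_generator_pauliZZ (A : Arrangement G p) (k : Fin p × G.edgeSet) (i j : Fin N) :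
    SignComm (generator A k) (pauliZ i * pauliZ j) :=
  (signComm_pauliZY_pauliZ _ _ _).mul_right (signComm_pauliZY_pauliZ _ _ _)

theorem signComm_generator_generator (A : Arrangement G p) (k k' : Fin p × G.edgeSet) :
    SignComm (generator A k) (generator A k') :=
  signComm_pauliZY_pauliZY _ _ _ _

theorem generator_mul_edgeZZ (A : Arrangement G p) (g : Fin p × G.edgeSet) :
    generator A g * edgeZZ (g.2 : Sym2 (Fin N)) = Complex.I • pauliX (ySite A g) := by
  rw [edgeZZ_eq A g, generator, pauliZY_mul_pauliZ_mul_pauliZ (zSite_ne_ySite A g)]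

/-- An edge other than that of `g` does not contribute to the coefficient of a path whose only
sine branch is at `g`. -/
theorem coeff_edgeZZ_eq_zero (A : Arrangement G p) (g : Fin p × G.edgeSet)
    (s : Fin p × G.edgeSet → Fin 3) (hg : s g = 2) (hs : ∀ k, k ≠ g → s k ≠ 2)
    (e : Sym2 (Fin N)) (he : e ∈ G.edgeSet) (hne : e ≠ g.2) : coeff A (edgeZZ e) s = 0 := by
  obtain ⟨l₂, l₁, hl⟩ := List.append_of_mem (mem_gateList A g)
  have hnd := nodup_gateList A
  rw [hl, List.nodup_append] at hnd
  have hd : ¬ e.IsDiag := G.not_isDiag_of_mem_edgeSet he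
  have hQ : ∀ k, SignComm (generator A k) (edgeZZ e) := fun k => by
    induction e using Sym2.ind with
    | _ a b => exact signComm_generator_pauliZZ A k a b
  obtain ⟨z, hz⟩ := prod_conjTerm_split_eq_smul (S := generator A) (s := s) (generator_sq A)
    (signComm_generator_generator A) l₁ l₂ g hQ hg
    (fun k hk => hs k (by rintro rfl; exact (List.nodup_cons.1 hnd.2.1).1 hk))
    (fun k hk => hs k (hnd.2.2 k hk g List.mem_cons_self))
  have hsq : (edgeZZ (g.2 : Sym2 (Fin N)) * edgeZZ (g.2 : Sym2 (Fin N)) : Op N) = 1 := by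
    rw [edgeZZ_eq A g]
    rw [mul_assoc, ← mul_assoc (pauliZ (ySite A g)), pauliZ_mul_comm (ySite A g), mul_assoc,
      pauliZ_sq, mul_one, pauliZ_sq]
  -- Inserting the square of `Z_i Z_j` for the edge of `g` exposes `X_j`, which the plus state
  -- absorbs, and leaves a product of two distinct edges.
  have hprod : generator A g * edgeZZ e =
      Complex.I • (pauliX (ySite A g) * (edgeZZ (g.2 : Sym2 (Fin N)) * edgeZZ e)) := by
    rw [← smul_mul_assoc, ← generator_mul_edgeZZ, mul_assoc, ← mul_assoc (edgeZZ _) (edgeZZ _),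
      hsq, one_mul]
  rw [coeff, hl, hz, hprod, map_smul, map_smul, plusFunctional_pauliX_mul, edgeZZ_eq A g,
    plusFunctional_edgeZZ_mul_eq_zero hd (by rwa [sym2_sites]), smul_zero, smul_zero]

/-- The gates that a path with its sine branch at `g` may meet nontrivially. -/
def MayMeet (A : Arrangement G p) (g k : Fin p × G.edgeSet) : Prop :=
  (g.1 ≤ k.1 ∧ (ySite A k = zSite A g ∨ ySite A k = ySite A g)) ∨
    (k.1 ≤ g.1 ∧ (zSite A k = ySite A g ∨ ySite A k = ySite A g))

open Classical in
/-- The path that starts from `Z_i Z_j` for the edge of `g` and takes its only sine branch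
at `g`. -/
theorem exists_path [DecidableRel G.Adj] (A : Arrangement G p) (g : Fin p × G.edgeSet) :
    ∃ s : Fin p × G.edgeSet → Fin 3, s g = 2 ∧ (∀ k, k ≠ g → s k ≠ 2) ∧
      (∀ k, s k ≠ 0 → MayMeet A g k) ∧ coeff A (hamiltonian G) s = -1 := by
  obtain ⟨l₂, l₁, hl⟩ := List.append_of_mem (mem_gateList A g)
  have hnd := nodup_gateList A
  have hpw := pairwise_gateList A
  rw [hl, List.nodup_append] at hnd
  rw [hl, List.pairwise_append, List.pairwise_cons] at hpw
  set Q : Op N := edgeZZ (g.2 : Sym2 (Fin N)) with hQ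
  set X : Op N := generator A g * Q with hX
  have hg₁ : g ∉ l₁ := (List.nodup_cons.1 hnd.2.1).1
  have hg₂ : ∀ k ∈ l₂, k ≠ g := fun k hk => hnd.2.2 k hk g List.mem_cons_self
  have hSQ : ∀ k, SignComm (generator A k) Q := fun k => by
    rw [hQ, edgeZZ_eq A g]; exact signComm_generator_pauliZZ A k _ _
  have hSX : ∀ k, SignComm (generator A k) X := fun k =>
    (signComm_generator_generator A k g).mul_right (hSQ k)
  -- The list runs in the order of action on the state, so observables meet it from the right: gates
  -- in `l₁` see `Q`, then `g` turns it into `X`, which gates in `l₂` see. Off `g` the path takes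
  -- the only surviving branch, constant or cosine.
  let s : Fin p × G.edgeSet → Fin 3 := fun k =>
    if k = g then 2 else
      if k ∈ l₁ then (if generator A k * Q = Q * generator A k then 0 else 1)
      else (if generator A k * X = X * generator A k then 0 else 1)
  have hsg : s g = 2 := if_pos rfl
  have hs2 : ∀ k, k ≠ g → s k ≠ 2 := by
    intro k hk
    simp only [s, if_neg hk]
    split_ifs <;> decide
  have hs₁ : ∀ k ∈ l₁, s k = if generator A k * Q = Q * generator A k then 0 else 1 := by
    intro k hk
    have : k ≠ g := by rintro rfl; exact hg₁ hk
    simp only [s, if_neg this, if_pos hk]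
  have hs₂ : ∀ k ∈ l₂, s k = if generator A k * X = X * generator A k then 0 else 1 := by
    intro k hk
    have : k ∉ l₁ := fun h => hnd.2.2 k hk k (List.mem_cons_of_mem _ h) rfl
    simp only [s, if_neg (hg₂ k hk), if_neg this]
  have aux : ∀ k, ∀ O : Op N, SignComm (generator A k) O →
      s k = (if generator A k * O = O * generator A k then 0 else 1) →
      (generator A k * O = O * generator A k ∧ s k = 0) ∨
        (generator A k * O = -(O * generator A k) ∧ s k = 1) := by
    intro k O hO hk
    by_cases h : generator A k * O = O * generator A k
    · exact Or.inl ⟨h, by rw [hk, if_pos h]⟩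
    · exact Or.inr ⟨hO.resolve_left h, by rw [hk, if_neg h]⟩
  refine ⟨s, hsg, hs2, ?_, ?_⟩
  · intro k hk
    by_cases hkg : k = g
    · subst hkg; exact Or.inl ⟨le_rfl, Or.inr rfl⟩
    have hmem := mem_gateList A k
    rw [hl, List.mem_append, List.mem_cons] at hmem
    rcases hmem with h | h | h
    · refine Or.inr ⟨hpw.2.2 k h g List.mem_cons_self, ?_⟩
      by_contra! hcon
      refine hk ?_
      rw [hs₂ k h, if_pos]
      rw [hX, hQ, generator_mul_edgeZZ, mul_smul_comm, smul_mul_assoc]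
      congr 1
      exact pauliZY_comm_pauliX hcon.1 hcon.2
    · exact absurd h hkg
    · refine Or.inl ⟨hpw.2.1.1 k h, ?_⟩
      by_contra! hcon
      refine hk ?_
      rw [hs₁ k h, if_pos]
      rw [hQ, edgeZZ_eq A g]
      exact commute_mul_right (pauliZY_comm_pauliZ hcon.1) (pauliZY_comm_pauliZ hcon.2)
  -- The sign is `I * I`: one factor from the sine branch, one from `Y_j Z_j = I • X_j`.
  · have hmain : coeff A Q s = -1 := by
      rw [coeff, hl, prod_conjTerm_split_eq (generator_sq A) l₁ l₂ g hsg _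
        (fun k hk => aux k Q (hSQ k) (hs₁ k hk)) (fun k hk => aux k X (hSX k) (hs₂ k hk)),
        hQ, generator_mul_edgeZZ, smul_smul, Complex.I_mul_I, map_smul, plusFunctional_pauliX,
        smul_eq_mul, mul_one]
      rw [hQ, edgeZZ_eq A g]
      exact pauliZY_anticomm (zSite_ne_ySite A g)
    have hsum : coeff A (hamiltonian G) s = ∑ e ∈ G.edgeFinset, coeff A (edgeZZ e) s := by
      simp only [coeff, hamiltonian, map_sum]
    rw [hsum, Finset.sum_eq_single (g.2 : Sym2 (Fin N)), hmain]
    · intro e he hne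
      exact coeff_edgeZZ_eq_zero A g s hsg hs2 e (SimpleGraph.mem_edgeFinset.1 he) hne
    · intro h
      exact absurd (SimpleGraph.mem_edgeFinset.2 g.2.2) h

end Paths

/-! ### Counting the nonconstant factors of a path -/

section Counting

variable {N p D : ℕ} {G : SimpleGraph (Fin N)} [DecidableRel G.Adj]

theorem card_fst_add_card_snd (A : Arrangement G p) (hG : G.IsRegularOfDegree D) (v : Fin N) :
    (Finset.univ.filter fun e => A.fst e = v).card +
      (Finset.univ.filter fun e => A.snd e = v).card = D := by
  classical
  rw [← hG v, ← SimpleGraph.card_incidenceFinset_eq_degree, ← Finset.card_union_of_disjoint]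
  · refine Finset.card_bij (fun e _ => (e : Sym2 (Fin N))) ?_ ?_ ?_
    · intro e he
      rw [SimpleGraph.mem_incidenceFinset]
      refine ⟨e.2, ?_⟩
      rw [← A.mk_fst_snd e, Sym2.mem_iff]
      simp only [Finset.mem_union, Finset.mem_filter, Finset.mem_univ, true_and] at he
      exact he.imp Eq.symm Eq.symm
    · intro e _ e' _ h
      exact Subtype.ext h
    · intro e he
      rw [SimpleGraph.mem_incidenceFinset] at he
      refine ⟨⟨e, he.1⟩, ?_, rfl⟩
      have : v ∈ s(A.fst ⟨e, he.1⟩, A.snd ⟨e, he.1⟩) := by rw [A.mk_fst_snd]; exact he.2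
      rw [Sym2.mem_iff] at this
      simp only [Finset.mem_union, Finset.mem_filter, Finset.mem_univ, true_and]
      exact this.imp Eq.symm Eq.symm
  · rw [Finset.disjoint_filter]
    intro e _ h h'
    exact A.fst_ne_snd e (h.trans h'.symm)

/-- The number of gates of round `n` that act by `Y` on the qubit `v`. -/
def yCount (A : Arrangement G p) (n : ℕ) (v : Fin N) : ℕ :=
  if Even n then (Finset.univ.filter fun e => A.snd e = v).card
  else (Finset.univ.filter fun e => A.fst e = v).card

theorem yCount_eq (A : Arrangement G p) (l : Fin p) (v : Fin N) :
    (Finset.univ.filter fun e => ySite A (l, e) = v).card = yCount A l v := by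
  unfold ySite yCount
  split_ifs <;> rfl

theorem yCount_add_card_zSite (A : Arrangement G p) (hG : G.IsRegularOfDegree D) (l : Fin p)
    (v : Fin N) :
    yCount A l v + (Finset.univ.filter fun e => zSite A (l, e) = v).card = D := by
  rw [← card_fst_add_card_snd A hG v]
  unfold zSite yCount
  split_ifs
  · rw [add_comm]
  · rfl

/-- Rounds of opposite parity exchange `Y` and `Z`, so each of the `D` edges at `v` puts `Y` on `v`
in exactly one of the two. -/
theorem yCount_add_succ (A : Arrangement G p) (hG : G.IsRegularOfDegree D) (n : ℕ) (v : Fin N) :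
    yCount A n v + yCount A (n + 1) v = D := by
  rw [← card_fst_add_card_snd A hG v]
  unfold yCount
  rcases Nat.even_or_odd n with h | h
  · rw [if_pos h, if_neg (by simpa [Nat.even_add_one] using h), add_comm]
  · rw [if_neg (Nat.not_even_iff_odd.2 h), if_pos (by simpa [Nat.even_add_one] using h)]

/-- The bound on the number of gates of round `n` met by a path with sine branch in round `r`. -/
def roundBound (A : Arrangement G p) (D r : ℕ) (i j : Fin N) (n : ℕ) : ℕ :=
  if n < r then D else if n = r then yCount A n i + D else yCount A n i + yCount A n j

-- In the round of `g` itself the gate order is arbitrary, so gates on either side of `g` must be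
-- allowed for: those with `Y` on `i`, plus all those touching `j`.
open Classical in
theorem card_mayMeet_round_le (A : Arrangement G p) (hG : G.IsRegularOfDegree D)
    (g : Fin p × G.edgeSet) (l : Fin p) :
    (Finset.univ.filter fun e => MayMeet A g (l, e)).card ≤
      roundBound A D g.1 (zSite A g) (ySite A g) l := by
  have htouch : ∀ v, (Finset.univ.filter fun e => zSite A (l, e) = v ∨ ySite A (l, e) = v).card
      ≤ D := by
    intro v
    rw [Finset.filter_or]
    refine (Finset.card_union_le _ _).trans ?_
    rw [yCount_eq, add_comm, yCount_add_card_zSite A hG]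
  unfold roundBound
  split_ifs with h1 h2
  · refine (Finset.card_le_card ?_).trans (htouch (ySite A g))
    intro e he
    simp only [Finset.mem_filter, Finset.mem_univ, true_and] at he ⊢
    rcases he with ⟨h, _⟩ | ⟨_, h⟩
    · exact absurd (Fin.lt_def.2 h1) (not_lt.2 h)
    · exact h
  · refine (Finset.card_le_card (t := (Finset.univ.filter fun e => ySite A (l, e) = zSite A g) ∪
      Finset.univ.filter fun e => zSite A (l, e) = ySite A g ∨ ySite A (l, e) = ySite A g) ?_).trans
      ((Finset.card_union_le _ _).trans (add_le_add (yCount_eq A l _).le (htouch _)))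
    intro e he
    simp only [Finset.mem_union, Finset.mem_filter, Finset.mem_univ, true_and] at he ⊢
    rcases he with ⟨_, h⟩ | ⟨_, h⟩
    · exact h.imp_right Or.inr
    · exact Or.inr h
  · refine (Finset.card_le_card (t := (Finset.univ.filter fun e => ySite A (l, e) = zSite A g) ∪
      Finset.univ.filter fun e => ySite A (l, e) = ySite A g) ?_).trans
      ((Finset.card_union_le _ _).trans (add_le_add (yCount_eq A l _).le (yCount_eq A l _).le))
    intro e he
    simp only [Finset.mem_union, Finset.mem_filter, Finset.mem_univ, true_and] at he ⊢
    rcases he with ⟨_, h⟩ | ⟨h, _⟩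
    · exact h
    · have := Fin.le_def.1 h
      dsimp only at this
      omega

/-- Each pair of rounds after the first two contributes exactly `2D`; the excess over `D` per round
comes from the first pair, where one qubit is overcounted. -/
theorem sum_roundBound (A : Arrangement G p) (hG : G.IsRegularOfDegree D) {r : ℕ} (hr : r < 2)
    (i j : Fin N) {m : ℕ} (hm : 1 ≤ m) :
    ∑ n ∈ Finset.range (2 * m), roundBound A D r i j n =
      2 * m * D + (if r = 0 then yCount A 1 j else yCount A 1 i) := by
  induction m, hm using Nat.le_induction with
  | base =>
    have hi := yCount_add_succ A hG 0 i
    interval_cases r <;>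
      simp [Finset.sum_range_succ, roundBound] at hi ⊢ <;> omega
  | succ m hm ih =>
    have hi := yCount_add_succ A hG (2 * m) i
    have hj := yCount_add_succ A hG (2 * m) j
    have h1 : roundBound A D r i j (2 * m) = yCount A (2 * m) i + yCount A (2 * m) j := by
      unfold roundBound; rw [if_neg (by omega), if_neg (by omega)]
    have h2 : roundBound A D r i j (2 * m + 1) =
        yCount A (2 * m + 1) i + yCount A (2 * m + 1) j := by
      unfold roundBound; rw [if_neg (by omega), if_neg (by omega)]
    rw [show 2 * (m + 1) = 2 * m + 1 + 1 by ring, Finset.sum_range_succ, Finset.sum_range_succ, ih,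
      h1, h2]
    linear_combination hi + hj

open Classical in
theorem card_mayMeet_lt (A : Arrangement G p) (hG : G.IsRegularOfDegree D) (hp : Even p)
    (g : Fin p × G.edgeSet) (hg : (g.1 : ℕ) < 2) :
    (Finset.univ.filter fun k => MayMeet A g k).card < D * (p + 1) := by
  obtain ⟨m, hm⟩ := hp
  have hgp := g.1.2
  have hcard : (Finset.univ.filter fun k => MayMeet A g k).card =
      ∑ l, (Finset.univ.filter fun e => MayMeet A g (l, e)).card := by
    simp only [Finset.card_filter]
    exact Fintype.sum_prod_type _
  have hle := Finset.sum_le_sum fun l (_ : l ∈ Finset.univ) => card_mayMeet_round_le A hG g l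
  rw [Fin.sum_univ_eq_sum_range (roundBound A D g.1 (zSite A g) (ySite A g)),
    show Finset.range p = Finset.range (2 * m) by rw [hm, two_mul],
    sum_roundBound A hG hg _ _ (by omega)] at hle
  -- Strictness comes from `g` itself: in the first round it uses one of the `D` edges at `j` for
  -- `Y`, leaving at most `D - 1` in the second; in the second round it acts on `i` by `Z`, not `Y`.
  have hlast : (if (g.1 : ℕ) = 0 then yCount A 1 (ySite A g) else yCount A 1 (zSite A g)) < D := by
    split_ifs with h
    · have h1 := yCount_add_succ A hG 0 (ySite A g)
      have h2 := yCount_eq A g.1 (ySite A g)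
      have h3 : 0 < (Finset.univ.filter fun e => ySite A (g.1, e) = ySite A g).card :=
        Finset.card_pos.2 ⟨g.2, by simp⟩
      rw [h] at h2
      rw [zero_add] at h1
      omega
    · have h1 := yCount_add_card_zSite A hG g.1 (zSite A g)
      have h3 : 0 < (Finset.univ.filter fun e => zSite A (g.1, e) = zSite A g).card :=
        Finset.card_pos.2 ⟨g.2, by simp⟩
      rw [show (g.1 : ℕ) = 1 by omega] at h1
      omega
  rw [hcard]
  calc _ ≤ _ := hle
    _ < 2 * m * D + D := by omega
    _ = D * (p + 1) := by rw [hm]; ring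

end Counting

/-! ### Bounds on the ground energy -/

section GroundEnergy

variable {N : ℕ}

/-- Conjugation by `Y_i` preserves the trace but flips the sign. -/
theorem trace_pauliZ_mul_pauliZ {i j : Fin N} (h : i ≠ j) :
    (pauliZ i * pauliZ j : Op N).trace = 0 := by
  have h1 : (pauliY i * (pauliZ i * pauliZ j) : Op N) = -(pauliZ i * pauliZ j * pauliY i) := by
    rw [← mul_assoc, pauliY_mul_pauliZ_anticomm, neg_mul, mul_assoc, pauliY_comm_pauliZ h,
      mul_assoc]
  have h2 : (pauliZ i * pauliZ j : Op N).trace = (pauliY i * (pauliZ i * pauliZ j) * pauliY i).trace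
      := by
    rw [Matrix.trace_mul_comm (pauliY i * _), ← mul_assoc, pauliY_sq, one_mul]
  rw [h1, neg_mul, mul_assoc, pauliY_sq, mul_one, Matrix.trace_neg] at h2
  exact self_eq_neg.1 h2

theorem exists_edgeZZ_eq_diagonal (e : Sym2 (Fin N)) (he : ¬ e.IsDiag) :
    ∃ d : (Fin N → Fin 2) → ℝ, edgeZZ e = Matrix.diagonal (fun x => (d x : ℂ)) ∧
      (∀ x, |d x| ≤ 1) ∧ ∑ x, d x = 0 ∧ d 0 = 1 := by
  induction e using Sym2.ind with
  | _ i j =>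
    have hij : i ≠ j := by simpa using he
    let z : Fin 2 → ℝ := ![1, -1]
    have hz : ∀ k : Fin N, (pauliZ k : Op N) = Matrix.diagonal fun x => ((z (x k) : ℝ) : ℂ) := by
      intro k
      rw [pauliZ_eq_diagonal]
      congr 1
      funext x
      generalize x k = b
      fin_cases b <;> simp [z]
    have hE : edgeZZ s(i, j) = Matrix.diagonal
        (fun x : Fin N → Fin 2 => ((z (x i) * z (x j) : ℝ) : ℂ)) := by
      change pauliZ i * pauliZ j = _
      rw [hz, hz, Matrix.diagonal_mul_diagonal]
      simp only [Complex.ofReal_mul]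
    refine ⟨fun x => z (x i) * z (x j), hE, ?_, ?_, ?_⟩
    · intro x
      have : ∀ b, |z b| = 1 := by intro b; fin_cases b <;> simp [z]
      simp only [abs_mul, this, mul_one, le_refl]
    · have := trace_pauliZ_mul_pauliZ hij
      rw [show (pauliZ i * pauliZ j : Op N) = _ from hE, Matrix.trace_diagonal] at this
      exact_mod_cast this
    · simp [z]

variable (G : SimpleGraph (Fin N)) [DecidableRel G.Adj]

theorem exists_hamiltonian_eq_diagonal :
    ∃ d : (Fin N → Fin 2) → ℝ, hamiltonian G = Matrix.diagonal (fun x => (d x : ℂ)) ∧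
      (∀ x, |d x| ≤ G.edgeFinset.card) ∧ ∑ x, d x = 0 ∧ d 0 = G.edgeFinset.card := by
  have h : ∀ e : Sym2 (Fin N), ∃ d : (Fin N → Fin 2) → ℝ, e ∈ G.edgeFinset →
      edgeZZ e = Matrix.diagonal (fun x => (d x : ℂ)) ∧
      (∀ x, |d x| ≤ 1) ∧ ∑ x, d x = 0 ∧ d 0 = 1 := by
    intro e
    by_cases he : e.IsDiag
    -- A dummy value: loops are never edges.
    · exact ⟨0, fun h => absurd he (G.not_isDiag_of_mem_edgeFinset h)⟩
    · obtain ⟨d, hd⟩ := exists_edgeZZ_eq_diagonal e he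
      exact ⟨d, fun _ => hd⟩
  choose d hd using h
  refine ⟨fun x => ∑ e ∈ G.edgeFinset, d e x, ?_, ?_, ?_, ?_⟩
  · rw [hamiltonian, Finset.sum_congr rfl fun e he => (hd e he).1]
    ext x y
    rw [Matrix.sum_apply]
    by_cases hxy : x = y
    · subst hxy; simp
    · simp [Matrix.diagonal_apply_ne _ hxy]
  · intro x
    refine (Finset.abs_sum_le_sum_abs _ _).trans ?_
    refine (Finset.sum_le_sum fun e he => (hd e he).2.1 x).trans ?_
    simp
  · rw [Finset.sum_comm]
    exact Finset.sum_eq_zero fun e he => (hd e he).2.2.1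
  · change ∑ e ∈ G.edgeFinset, d e 0 = _
    rw [Finset.sum_congr rfl fun e he => (hd e he).2.2.2]
    simp

theorem groundEnergy_bounds (hE : G.edgeFinset.Nonempty) :
    groundEnergy G < 0 ∧ -(G.edgeFinset.card : ℝ) ≤ groundEnergy G := by
  obtain ⟨d, hH, hle, hsum, h0⟩ := exists_hamiltonian_eq_diagonal G
  have hlow : ∀ E ∈ {E : ℝ | ∃ v : (Fin N → Fin 2) → ℂ, v ≠ 0 ∧ hamiltonian G *ᵥ v = (E : ℂ) • v},
      -(G.edgeFinset.card : ℝ) ≤ E := by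
    rintro E ⟨v, hv, hEv⟩
    obtain ⟨x, hx⟩ := Function.ne_iff.1 hv
    have h := congrFun hEv x
    rw [hH, Matrix.mulVec_diagonal, Pi.smul_apply, smul_eq_mul] at h
    have hdx : d x = E := by exact_mod_cast mul_right_cancel₀ hx h
    rw [← hdx]
    exact (abs_le.1 (hle x)).1
  have hmem : ∀ x, d x ∈
      {E : ℝ | ∃ v : (Fin N → Fin 2) → ℂ, v ≠ 0 ∧ hamiltonian G *ᵥ v = (E : ℂ) • v} := by
    intro x
    refine ⟨Pi.single x 1, by simp, ?_⟩
    rw [hH]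
    funext y
    rw [Matrix.mulVec_diagonal, Pi.smul_apply, smul_eq_mul]
    by_cases hy : y = x
    · rw [hy]
    · simp [hy]
  -- The diagonal entries sum to zero, while the one at `0` is the positive number of edges.
  obtain ⟨x, hx⟩ : ∃ x, d x < 0 := by
    by_contra! hcon
    have := (Finset.sum_eq_zero_iff_of_nonneg fun x _ => hcon x).1 hsum 0 (Finset.mem_univ _)
    rw [h0, Nat.cast_eq_zero, Finset.card_eq_zero] at this
    exact hE.ne_empty this
  exact ⟨csInf_lt_of_lt ⟨_, hlow⟩ (hmem x) hx, le_csInf ⟨_, hmem x⟩ hlow⟩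

theorem two_mul_card_edgeFinset {D : ℕ} (hG : G.IsRegularOfDegree D) :
    2 * G.edgeFinset.card = D * N := by
  rw [← G.sum_degrees_eq_twice_card_edges, Finset.sum_congr rfl fun v _ => hG v]
  simp [mul_comm]

end GroundEnergy

/-! ### The variance bound and its consequences -/

section Main

variable {N p D : ℕ} {G : SimpleGraph (Fin N)} [DecidableRel G.Adj]

theorem energyVariance_eq (A : Arrangement G p) :
    energyVariance A = (∑ s ∈ Finset.univ.erase 0, (coeff A (hamiltonian G) s).re ^ 2 *
      (1 / 2 : ℝ) ^ (Finset.univ.filter fun k => s k ≠ 0).card) / groundEnergy G ^ 2 := by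
  simp only [energyVariance, div_eq_mul_inv, variance_mul_const, inv_pow]
  congr 1
  simp only [expectation_ansatzState]
  exact variance_trig_polynomial _

theorem le_energyVariance (A : Arrangement G p) (hG : G.IsRegularOfDegree D) (hp : Even p)
    (hp0 : 0 < p) :
    (D * N : ℝ) / (groundEnergy G ^ 2 * 2 ^ (D * (p + 1) - 1)) ≤ energyVariance A := by
  classical
  have hp2 : 2 ≤ p := by obtain ⟨m, hm⟩ := hp; omega
  choose s hsg hs2 hmeet hcoeff using fun g => exists_path A g
  -- The gates of the first two rounds, `2|E| = DN` in number.
  let ι : Fin 2 × G.edgeSet → Fin p × G.edgeSet := fun q => (Fin.castLE hp2 q.1, q.2)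
  have hι : Function.Injective ι := by
    rintro ⟨r, e⟩ ⟨r', e'⟩ h
    obtain ⟨h1, h2⟩ := Prod.mk.inj h
    exact Prod.ext (Fin.castLE_injective hp2 h1) h2
  -- A path determines its gate as the unique place of the sine branch.
  have hs : Function.Injective s := by
    intro g g' h
    by_contra hne
    exact hs2 g' g hne (by rw [← h, hsg])
  have hcard : ((Finset.univ : Finset (Fin 2 × G.edgeSet)).card : ℝ) = D * N := by
    rw [Finset.card_univ, Fintype.card_prod, Fintype.card_fin, ← SimpleGraph.edgeFinset_card,
      two_mul_card_edgeFinset G hG]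
    push_cast; rfl
  rw [energyVariance_eq, mul_comm (groundEnergy G ^ 2), ← div_div]
  refine div_le_div_of_nonneg_right ?_ (sq_nonneg _)
  calc (D * N : ℝ) / 2 ^ (D * (p + 1) - 1)
      = ∑ _q : Fin 2 × G.edgeSet, (1 / 2 : ℝ) ^ (D * (p + 1) - 1) := by
        rw [Finset.sum_const, nsmul_eq_mul, hcard, one_div, inv_pow, div_eq_mul_inv]
    _ ≤ ∑ q : Fin 2 × G.edgeSet, (coeff A (hamiltonian G) (s (ι q))).re ^ 2 *
          (1 / 2 : ℝ) ^ (Finset.univ.filter fun k => s (ι q) k ≠ 0).card := by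
        refine Finset.sum_le_sum fun q _ => ?_
        rw [hcoeff, Complex.neg_re, Complex.one_re, neg_one_sq, one_mul]
        refine pow_le_pow_of_le_one (by norm_num) (by norm_num) (Nat.le_sub_one_of_lt ?_)
        refine lt_of_le_of_lt (Finset.card_le_card fun k hk => ?_)
          (card_mayMeet_lt A hG hp (ι q) q.1.2)
        rw [Finset.mem_filter] at hk ⊢
        exact ⟨hk.1, hmeet _ k hk.2⟩
    _ = ∑ t ∈ Finset.univ.image (s ∘ ι), (coeff A (hamiltonian G) t).re ^ 2 *
          (1 / 2 : ℝ) ^ (Finset.univ.filter fun k => t k ≠ 0).card := by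
        rw [Finset.sum_image fun _ _ _ _ h => (hs.comp hι) h]
        rfl
    _ ≤ _ := by
        refine Finset.sum_le_sum_of_subset_of_nonneg (fun t ht => ?_) fun t _ _ => by positivity
        obtain ⟨q, _, rfl⟩ := Finset.mem_image.1 ht
        refine Finset.mem_erase.2 ⟨fun h => ?_, Finset.mem_univ _⟩
        have h20 : (2 : Fin 3) = 0 := (hsg (ι q)).symm.trans (congrFun h (ι q))
        exact absurd h20 (by decide)

theorem groundEnergy_sq_bounds (hG : G.IsRegularOfDegree D) (hN : 0 < N) (hD : 0 < D) :
    0 < groundEnergy G ^ 2 ∧ groundEnergy G ^ 2 ≤ ((D : ℝ) * N) ^ 2 := by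
  have hcard := two_mul_card_edgeFinset G hG
  have hpos : 0 < D * N := Nat.mul_pos hD hN
  obtain ⟨h1, h2⟩ := groundEnergy_bounds G (Finset.card_pos.1 (by omega))
  have hle : (G.edgeFinset.card : ℝ) ≤ (D : ℝ) * N := by exact_mod_cast (by omega)
  exact ⟨sq_pos_of_neg h1, sq_le_sq' (by linarith) (by linarith)⟩

/-- Since `E₀² ≤ (DN)²`, the ratio `DN / E₀²` is at least `1 / (DN)`, so the exponent `1` suffices.
Using `Δ + 1` keeps the constant well defined and positive even for `Δ = 0`. -/
theorem polynomial_le_energyVariance {Δ : ℕ} (A : Arrangement G p) (hG : G.IsRegularOfDegree D)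
    (hp : Even p) (hp0 : 0 < p) (hN : 0 < N) (hD : 0 < D) (hΔ : D ≤ Δ) :
    (1 / ((Δ + 1) * 2 ^ (Δ * (p + 1))) : ℝ) / (N : ℝ) ^ 1 ≤ energyVariance A := by
  refine le_trans ?_ (le_energyVariance A hG hp hp0)
  obtain ⟨h0, h1⟩ := groundEnergy_sq_bounds hG hN hD
  have hN' : (0 : ℝ) < N := by exact_mod_cast hN
  have hD' : (0 : ℝ) < D := by exact_mod_cast hD
  have hΔ' : (D : ℝ) ≤ Δ + 1 := by
    have : (D : ℝ) ≤ Δ := by exact_mod_cast hΔ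
    linarith
  have hpow : (2 : ℝ) ^ (D * (p + 1) - 1) ≤ 2 ^ (Δ * (p + 1)) :=
    pow_le_pow_right₀ one_le_two ((Nat.sub_le _ _).trans (Nat.mul_le_mul_right _ hΔ))
  calc (1 / ((Δ + 1) * 2 ^ (Δ * (p + 1))) : ℝ) / (N : ℝ) ^ 1
      = 1 / ((Δ + 1) * N * 2 ^ (Δ * (p + 1))) := by
        rw [div_div, pow_one]; ring_nf
    _ ≤ 1 / (D * N * 2 ^ (D * (p + 1) - 1)) := by
        refine one_div_le_one_div_of_le (by positivity) ?_
        gcongr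
    _ = (D * N : ℝ) / ((D * N) ^ 2 * 2 ^ (D * (p + 1) - 1)) := by
        field_simp
    _ ≤ _ := by gcongr

end Main

/-- Exponential decay would bound `c` by a multiple of `N ^ k * r ^ N`, which tends to zero. -/
theorem not_barrenPlateau {N : ℕ → ℕ} {v : ℕ → ℝ} (hN : Tendsto N atTop atTop) {c : ℝ} (hc : 0 < c)
    (k : ℕ) (h : ∀ n, 0 < N n → c / (N n : ℝ) ^ k ≤ v n) : ¬ BarrenPlateau N v := by
  rintro ⟨r, hr0, hr1, hv⟩
  obtain ⟨C, hC⟩ := hv.bound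
  have hlim : Tendsto (fun n => C * ((N n : ℝ) ^ k * r ^ N n)) atTop (nhds (C * 0)) :=
    ((tendsto_pow_const_mul_const_pow_of_abs_lt_one k
      (by rwa [abs_of_pos hr0])).comp hN).const_mul C
  rw [mul_zero] at hlim
  refine absurd (ge_of_tendsto hlim ?_) (not_le.2 hc)
  filter_upwards [hC, hN.eventually_gt_atTop 0] with n hn hpos
  have hpos' : (0 : ℝ) < (N n : ℝ) ^ k := pow_pos (by exact_mod_cast hpos) k
  have h1 := (h n hpos).trans ((le_abs_self _).trans hn)
  rw [Real.norm_eq_abs, abs_of_pos (pow_pos hr0 _), div_le_iff₀ hpos'] at h1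
  linarith

end IHVA

theorem theorem2 :
    -- the lower bound on the variance
    (∀ (N D p : ℕ) (G : SimpleGraph (Fin N)) [DecidableRel G.Adj] (A : IHVA.Arrangement G p),
      0 < N → 0 < D → G.IsRegularOfDegree D → 0 < p → Even p →
        (D * N : ℝ) / (IHVA.groundEnergy G ^ 2 * 2 ^ (D * (p + 1) - 1)) ≤
          IHVA.energyVariance A) ∧
    -- for a constant number of rounds and bounded degree the variance decays at most polynomially
    (∀ Δ p : ℕ, 0 < p → Even p → ∃ (c : ℝ) (k : ℕ), 0 < c ∧
      ∀ (N D : ℕ) (G : SimpleGraph (Fin N)) [DecidableRel G.Adj] (A : IHVA.Arrangement G p),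
        0 < N → 0 < D → D ≤ Δ → G.IsRegularOfDegree D →
          c / (N : ℝ) ^ k ≤ IHVA.energyVariance A) ∧
    -- hence there is no barren plateau
    (∀ (Δ p : ℕ), 0 < p → Even p →
      ∀ (N D : ℕ → ℕ) (G : ∀ n, SimpleGraph (Fin (N n))) [∀ n, DecidableRel (G n).Adj]
        (A : ∀ n, IHVA.Arrangement (G n) p),
        Filter.Tendsto N Filter.atTop Filter.atTop →
        (∀ n, 0 < D n ∧ D n ≤ Δ ∧ (G n).IsRegularOfDegree (D n)) →
          ¬ IHVA.BarrenPlateau N fun n => IHVA.energyVariance (A n)) := by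
  refine ⟨fun N D p G _ A _ _ hG hp0 hp => IHVA.le_energyVariance A hG hp hp0, ?_, ?_⟩
  · intro Δ p hp0 hp
    exact ⟨1 / ((Δ + 1) * 2 ^ (Δ * (p + 1))), 1, by positivity, fun N D G _ A hN hD hΔ hG =>
      IHVA.polynomial_le_energyVariance A hG hp hp0 hN hD hΔ⟩
  · intro Δ p hp0 hp N D G _ A hN h
    exact IHVA.not_barrenPlateau hN (c := 1 / ((Δ + 1) * 2 ^ (Δ * (p + 1)))) (by positivity) 1
      fun n hn => IHVA.polynomial_le_energyVariance (A n) (h n).2.2 hp hp0 hn (h n).1 (h n).2.1
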